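/- Let $R$ be a (unital, associative) ring which is right semihereditary, i.e. every finitely generated right ideal of $R$ is projective. Let $\mathcal G$ be a Gabriel topology on $R$: a non-empty set of right ideals of $R$, closed under finite intersections and under passing to larger right ideals, such that $(I:x)=\{r\in R\mid xr\in I\}\in\mathcal G$ for all $I\in\mathcal G$ and $x\in R$, and such that a right ideal $K$ belongs to $\mathcal G$ whenever there is $I\in\mathcal G$ with $(K:x)\in\mathcal G$ for all $x\in I$. A right $R$-module $C$ is $\mathcal G$-closed if $\operatorname{Hom}_R(R,C)\to\operatorname{Hom}_R(I,C)$ is bijective for all $I\in\mathcal G$. Let $\lambda_{\mathcal G}\colon R\to Q_{\mathcal G}$ be the canonical ring homomorphism to the ring of quotients, which is the reflection of the right module $R$ in the category of $\mathcal G$-closed modules; explicitly, $Q_{\mathcal G}=\varinjlim_{I\in\mathcal G}\operatorname{Hom}_R(I,R/t(R))$, where $t(R)=\{x\in R\mid xI=0\text{ for some }I\in\mathcal G\}$. Assume that $\mathcal G$ is perfect, i.e. $\lambda_{\mathcal G}(I)Q_{\mathcal G}=Q_{\mathcal G}$ for all $I\in\mathcal G$. Let $(\mathcal T,\mathcal F)$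 be the hereditary torsion pair of right $R$-modules associated to $\mathcal G$, so that $\mathcal G=\{I\le R\mid R/I\in\mathcal T\}$, and let $\mathcal U$ be the class of all finitely presented modules in $\mathcal T$. Then $\lambda_{\mathcal G}$ is an epimorphism of rings, the universal localization of $R$ at $\mathcal U$ exists, and $\lambda_{\mathcal G}$ is equivalent to it: for every universal localization $\lambda_{\mathcal U}\colon R\to R_{\mathcal U}$ of $R$ at $\mathcal U$ there is a ring isomorphism $\varphi\colon Q_{\mathcal G}\to R_{\mathcal U}$ with $\lambda_{\mathcal U}=\varphi\lambda_{\mathcal G}$. Here a ring homomorphism $\lambda\colon R\to S$ is a universal localization of $R$ at $\mathcal U$ if there is a class $\Sigma$ of injective morphisms between finitely generated projective right $R$-modules, each with cokernel in $\mathcal U$ and containing for every $U\in\mathcal U$ some $\alpha\colon P\to Q$ with $0\to P\xrightarrow{\alpha}Q\to U\to0$ exact, such that $\alpha\otimes_RS$ is an isomorphism for all $\alpha\in\Sigma$, and every ring homomorphism $\psi\colon R\to T$ with $\alpha\otimes_RT$ an isomorphism for all $\alpha\in\Sigma$ factors uniquely as $\psi=\bar\psi\lambda$ with a ring homomorphism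 $\bar\psi\colon S\to T$. -/

import Mathlib

open MulOpposite
open scoped TensorProduct

universe u v

/-! Right `R`-modules are modules over `Rᵐᵒᵖ`, so right ideals of `R` are the (left) ideals of
`Rᵐᵒᵖ`, and `op r • m` is `m r`.  A Gabriel topology of right ideals of `R` is therefore
a filter `G : IdealFilter Rᵐᵒᵖ` with `G.IsGabriel`, and `I.colon {op x}` is
`(I : x) = {r | x r ∈ I}`. -/

namespace PerfectLocalization

section Torsion

variable {A : Type u} [Ring A] (G : IdealFilter A)

/-- The torsion submodule: all elements annihilated by an ideal in `G`. -/
def torsionSubmodule [G.IsUniform] (M : Type v) [AddCommGroup M] [Module A M] :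
    Submodule A M where
  carrier := {m | G.IsTorsionElem m}
  add_mem' := by
    rintro x y ⟨L, hL, hx⟩ ⟨L', hL', hy⟩
    refine ⟨L ⊓ L', Order.PFilter.inf_mem hL hL', fun a ha => ?_⟩
    rw [smul_add, hx a ha.1, hy a ha.2, add_zero]
  zero_mem' := by
    obtain ⟨L, hL⟩ := G.nonempty
    exact ⟨L, hL, fun a _ => smul_zero a⟩
  smul_mem' := by
    rintro c x ⟨L, hL, hx⟩
    refine ⟨L.colon {c}, IdealFilter.IsUniform.colon_mem hL c, fun a ha => ?_⟩
    rw [Submodule.mem_colon_singleton] at ha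
    rw [smul_smul]
    exact hx _ ha

variable {N : Type v} [AddCommGroup N] [Module A N]

/-- A submodule `D` of `N` is `G`-dense if `N ⧸ D` is `G`-torsion. -/
def IsDense (D : Submodule A N) : Prop := ∀ n : N, D.colon {n} ∈ G

variable {G}

theorem IsDense.top : IsDense G (⊤ : Submodule A N) := by
  intro n
  obtain ⟨L, hL⟩ := G.nonempty
  exact Order.PFilter.mem_of_le (fun a _ => by simp) hL

theorem IsDense.inf {D E : Submodule A N} (hD : IsDense G D) (hE : IsDense G E) :
    IsDense G (D ⊓ E) := fun n =>
  Order.PFilter.mem_of_le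
    (fun a ha => by
      simp only [Submodule.mem_inf, Submodule.mem_colon_singleton] at ha ⊢
      exact ha)
    (Order.PFilter.inf_mem (hD n) (hE n))

/-- `f` restricts to an `A`-linear map `D → N`. -/
def IsLinearOn (D : Submodule A N) (f : N → N) : Prop :=
  (∀ x ∈ D, ∀ y ∈ D, f (x + y) = f x + f y) ∧ ∀ (a : A), ∀ x ∈ D, f (a • x) = a • f x

theorem IsLinearOn.mono {D E : Submodule A N} {f : N → N} (h : IsLinearOn D f) (hE : E ≤ D) :
    IsLinearOn E f :=
  ⟨fun x hx y hy => h.1 x (hE hx) y (hE hy), fun a x hx => h.2 a x (hE hx)⟩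

/-- The submodule `{x ∈ D | f x ∈ E}`. -/
def preimageOn (D E : Submodule A N) (f : N → N) (hf : IsLinearOn D f) : Submodule A N where
  carrier := {x | x ∈ D ∧ f x ∈ E}
  add_mem' := by
    rintro x y ⟨hx, hx'⟩ ⟨hy, hy'⟩
    exact ⟨D.add_mem hx hy, by rw [hf.1 x hx y hy]; exact E.add_mem hx' hy'⟩
  zero_mem' := by
    refine ⟨D.zero_mem, ?_⟩
    have := hf.2 0 0 D.zero_mem
    rw [zero_smul, zero_smul] at this
    rw [this]; exact E.zero_mem
  smul_mem' := by
    rintro a x ⟨hx, hx'⟩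
    exact ⟨D.smul_mem a hx, by rw [hf.2 a x hx]; exact E.smul_mem a hx'⟩

theorem IsDense.preimageOn [G.IsGabriel] {D E : Submodule A N} (hD : IsDense G D)
    (hE : IsDense G E) {f : N → N} (hf : IsLinearOn D f) :
    IsDense G (preimageOn D E f hf) := by
  intro n
  refine IdealFilter.IsGabriel.gabriel_closed _ ⟨D.colon {n}, hD n, fun a ha => ?_⟩
  rw [Submodule.mem_colon_singleton] at ha
  refine Order.PFilter.mem_of_le (fun b hb => ?_) (hE (f (a • n)))
  rw [Submodule.mem_colon_singleton] at hb ⊢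
  rw [Submodule.mem_colon_singleton, smul_assoc]
  exact ⟨D.smul_mem b ha, by rw [hf.2 b _ ha]; exact hb⟩

end Torsion

section LocalizedEnd

variable {A : Type u} [Ring A] (G : IdealFilter A) (N : Type v) [AddCommGroup N] [Module A N]

/-- Functions that are linear on some `G`-dense submodule (the values elsewhere do not matter). -/
def DensePartialEnd : Type v := {f : N → N // ∃ D : Submodule A N, IsDense G D ∧ IsLinearOn D f}

/-- Two densely defined endomorphisms are identified if they agree on a `G`-dense submodule. -/
def denseSetoid : Setoid (DensePartialEnd G N) where
  r f g := ∃ D : Submodule A N, IsDense G D ∧ ∀ x ∈ D, f.1 x = g.1 x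
  iseqv :=
    { refl := fun _ => ⟨⊤, .top, fun _ _ => rfl⟩
      symm := fun ⟨D, hD, h⟩ => ⟨D, hD, fun x hx => (h x hx).symm⟩
      trans := fun ⟨D, hD, h⟩ ⟨E, hE, h'⟩ =>
        ⟨D ⊓ E, hD.inf hE, fun x hx => (h x hx.1).trans (h' x hx.2)⟩ }

/-- The direct limit of the groups `Hom_A(D, N)` over the `G`-dense submodules `D` of `N`, a ring
under addition and composition of densely defined endomorphisms. -/
def LocalizedEnd : Type v := Quotient (denseSetoid G N)

namespace LocalizedEnd

variable {G N}

/-- The class of a densely defined endomorphism. -/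
def mk (f : N → N) (h : ∃ D : Submodule A N, IsDense G D ∧ IsLinearOn D f) : LocalizedEnd G N :=
  Quotient.mk (denseSetoid G N) ⟨f, h⟩

theorem mk_eq_mk {f g : N → N} {hf hg} :
    (mk f hf : LocalizedEnd G N) = mk g hg ↔
      ∃ D : Submodule A N, IsDense G D ∧ ∀ x ∈ D, f x = g x :=
  ⟨fun h => Quotient.exact h, fun h => Quotient.sound h⟩

theorem ind {p : LocalizedEnd G N → Prop} (h : ∀ f hf, p (mk f hf)) (q : LocalizedEnd G N) :
    p q :=
  Quotient.inductionOn q fun f => h f.1 f.2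

/-- The class of an everywhere defined endomorphism. -/
def ofEnd (φ : N →ₗ[A] N) : LocalizedEnd G N :=
  mk φ ⟨⊤, .top, fun x _ y _ => map_add φ x y, fun a x _ => map_smul φ a x⟩

theorem add_aux {f g : N → N} (hf : ∃ D : Submodule A N, IsDense G D ∧ IsLinearOn D f)
    (hg : ∃ D : Submodule A N, IsDense G D ∧ IsLinearOn D g) :
    ∃ D : Submodule A N, IsDense G D ∧ IsLinearOn D (fun x => f x + g x) := by
  obtain ⟨D, hD, hf⟩ := hf
  obtain ⟨E, hE, hg⟩ := hg
  refine ⟨D ⊓ E, hD.inf hE, fun x hx y hy => ?_, fun a x hx => ?_⟩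
  · simp only [hf.1 x hx.1 y hy.1, hg.1 x hx.2 y hy.2]
    abel
  · simp only [hf.2 a x hx.1, hg.2 a x hx.2, smul_add]

theorem neg_aux {f : N → N} (hf : ∃ D : Submodule A N, IsDense G D ∧ IsLinearOn D f) :
    ∃ D : Submodule A N, IsDense G D ∧ IsLinearOn D (fun x => -f x) := by
  obtain ⟨D, hD, hf⟩ := hf
  refine ⟨D, hD, fun x hx y hy => ?_, fun a x hx => ?_⟩
  · simp only [hf.1 x hx y hy]
    abel
  · simp only [hf.2 a x hx, smul_neg]

theorem mul_aux [G.IsGabriel] {f g : N → N}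
    (hf : ∃ D : Submodule A N, IsDense G D ∧ IsLinearOn D f)
    (hg : ∃ D : Submodule A N, IsDense G D ∧ IsLinearOn D g) :
    ∃ D : Submodule A N, IsDense G D ∧ IsLinearOn D (fun x => f (g x)) := by
  obtain ⟨D, hD, hf⟩ := hf
  obtain ⟨E, hE, hg⟩ := hg
  refine ⟨preimageOn E D g hg, hE.preimageOn hD hg, fun x hx y hy => ?_, fun a x hx => ?_⟩
  · simp only [hg.1 x hx.1 y hy.1, hf.1 _ hx.2 _ hy.2]
  · simp only [hg.2 a x hx.1, hf.2 a _ hx.2]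

instance : Zero (LocalizedEnd G N) := ⟨ofEnd 0⟩
instance : One (LocalizedEnd G N) := ⟨ofEnd LinearMap.id⟩
instance : Neg (LocalizedEnd G N) :=
  ⟨Quotient.lift (fun f => mk (fun x => -f.1 x) (neg_aux f.2)) (by
    rintro f f' ⟨D, hD, h⟩
    exact mk_eq_mk.2 ⟨D, hD, fun x hx => by rw [h x hx]⟩)⟩
instance : Add (LocalizedEnd G N) :=
  ⟨Quotient.lift₂ (fun f g => mk (fun x => f.1 x + g.1 x) (add_aux f.2 g.2)) (by
    rintro f g f' g' ⟨D, hD, h⟩ ⟨E, hE, h'⟩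
    exact mk_eq_mk.2 ⟨D ⊓ E, hD.inf hE, fun x hx => by rw [h x hx.1, h' x hx.2]⟩)⟩
instance [G.IsGabriel] : Mul (LocalizedEnd G N) :=
  ⟨Quotient.lift₂ (fun f g => mk (fun x => f.1 (g.1 x)) (mul_aux f.2 g.2)) (by
    rintro f g f' g' ⟨D, hD, h⟩ ⟨E, hE, h'⟩
    obtain ⟨K, hK, hg⟩ := g.2
    exact mk_eq_mk.2 ⟨preimageOn K D g.1 hg ⊓ E, (hK.preimageOn hD hg).inf hE,
      fun x hx => by rw [← h' x hx.2, h _ hx.1.2]⟩)⟩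

theorem mk_add_mk {f g : N → N} {hf hg} :
    (mk f hf + mk g hg : LocalizedEnd G N) = mk (fun x => f x + g x) (add_aux hf hg) := rfl

theorem mk_mul_mk [G.IsGabriel] {f g : N → N} {hf hg} :
    (mk f hf * mk g hg : LocalizedEnd G N) = mk (fun x => f (g x)) (mul_aux hf hg) := rfl

theorem mk_congr {f g : N → N} {hf hg} (h : ∀ x, f x = g x) :
    (mk f hf : LocalizedEnd G N) = mk g hg :=
  mk_eq_mk.2 ⟨⊤, .top, fun x _ => h x⟩

instance [G.IsGabriel] : Ring (LocalizedEnd G N) where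
  add_assoc a b c := by
    induction a using ind; induction b using ind; induction c using ind
    exact mk_congr fun x => add_assoc _ _ _
  zero_add a := by
    induction a using ind
    exact mk_congr fun x => zero_add _
  add_zero a := by
    induction a using ind
    exact mk_congr fun x => add_zero _
  add_comm a b := by
    induction a using ind; induction b using ind
    exact mk_congr fun x => add_comm _ _
  neg_add_cancel a := by
    induction a using ind
    exact mk_congr fun x => neg_add_cancel _
  mul_assoc a b c := by
    induction a using ind; induction b using ind; induction c using ind
    rfl
  one_mul a := by
    induction a using ind
    exact mk_congr fun x => rfl
  mul_one a := by
    induction a using ind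
    exact mk_congr fun x => rfl
  zero_mul a := by
    induction a using ind
    exact mk_congr fun x => rfl
  mul_zero a := by
    induction a using ind with | _ f hf
    obtain ⟨D, hD, h⟩ := hf
    exact mk_congr fun x => by simpa using h.2 0 0 D.zero_mem
  left_distrib a b c := by
    induction a using ind with | _ f hf
    induction b using ind with | _ g hg
    induction c using ind with | _ k hk
    obtain ⟨D, hD, hf'⟩ := id hf
    obtain ⟨E, hE, hg'⟩ := id hg
    obtain ⟨K, hK, hk'⟩ := id hk
    exact mk_eq_mk.2 ⟨preimageOn E D g hg' ⊓ preimageOn K D k hk',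
      (hE.preimageOn hD hg').inf (hK.preimageOn hD hk'),
      fun x hx => hf'.1 _ hx.1.2 _ hx.2.2⟩
  right_distrib a b c := by
    induction a using ind; induction b using ind; induction c using ind
    rfl
  nsmul := nsmulRec
  zsmul := zsmulRec

end LocalizedEnd

end LocalizedEnd

section GClosed

variable {R : Type u} [Ring R] (G : IdealFilter Rᵐᵒᵖ)

/-- A right `R`-module `C` is `G`-closed if `Hom_R(R, C) → Hom_R(I, C)` is bijective for all
`I ∈ G`. -/
def IsGClosed (C : Type v) [AddCommGroup C] [Module Rᵐᵒᵖ C] : Prop :=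
  ∀ I ∈ G, Function.Bijective fun g : Rᵐᵒᵖ →ₗ[Rᵐᵒᵖ] C => g.domRestrict I

variable {G}

theorem IsGClosed.eq_zero {C : Type v} [AddCommGroup C] [Module Rᵐᵒᵖ C] (hC : IsGClosed G C)
    {I : Ideal Rᵐᵒᵖ} (hI : I ∈ G) {c : C} (h : ∀ a ∈ I, a • c = 0) : c = 0 := by
  have : LinearMap.toSpanSingleton Rᵐᵒᵖ C c = 0 := by
    apply (hC I hI).1
    ext a
    simpa using h a a.2
  simpa using congrArg (fun g => g 1) this

variable (G) in
/-- A left `R`-module `X` is `G`-divisible if `I X = X` for all `I ∈ G`. -/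
def IsGDivisible (X : Type v) [AddCommGroup X] [Module R X] : Prop :=
  ∀ I ∈ G, AddSubgroup.closure {y : X | ∃ a ∈ I, ∃ x : X, y = unop a • x} = ⊤

end GClosed

section QuotientRing

variable {R : Type u} [Ring R] (G : IdealFilter Rᵐᵒᵖ) [G.IsGabriel]

/-- The right module `R / t(R)`, where `t(R)` is the `G`-torsion submodule of `R`. -/
abbrev TorsionFreeQuotient : Type u := Rᵐᵒᵖ ⧸ torsionSubmodule G Rᵐᵒᵖ

/-- The ring of quotients `Q_G`: the direct limit of `Hom_R(I, R / t(R))` over `I ∈ G`, or,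
equivalently, of `Hom_R(D, R / t(R))` over the dense submodules `D` of `R / t(R)`. -/
abbrev QuotientRing : Type u := LocalizedEnd G (TorsionFreeQuotient G)

/-- The right `R`-linear endomorphism of `R / t(R)` induced by `x ↦ r x`. -/
def leftMul (r : R) : TorsionFreeQuotient G →ₗ[Rᵐᵒᵖ] TorsionFreeQuotient G :=
  Submodule.mapQ _ _ (LinearMap.toSpanSingleton Rᵐᵒᵖ Rᵐᵒᵖ (op r)) (by
    rintro x ⟨L, hL, h⟩
    refine ⟨L, hL, fun a ha => ?_⟩
    have := h a ha
    simp only [LinearMap.toSpanSingleton_apply, smul_eq_mul] at this ⊢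
    rw [← mul_assoc, this, zero_mul])

theorem leftMul_mk (r : R) (x : Rᵐᵒᵖ) :
    leftMul G r (Submodule.Quotient.mk x) = Submodule.Quotient.mk (x * op r) := rfl

/-- The canonical ring homomorphism `λ_G : R → Q_G`. -/
def toQuotientRing : R →+* QuotientRing G where
  toFun r := LocalizedEnd.ofEnd (leftMul G r)
  map_one' := LocalizedEnd.mk_congr fun x => by
    obtain ⟨x, rfl⟩ := Submodule.Quotient.mk_surjective _ x
    rw [leftMul_mk, op_one, mul_one]; rfl
  map_mul' r s := LocalizedEnd.mk_congr fun x => by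
    obtain ⟨x, rfl⟩ := Submodule.Quotient.mk_surjective _ x
    change _ = leftMul G r (leftMul G s _)
    rw [leftMul_mk, leftMul_mk, leftMul_mk, op_mul, mul_assoc]
  map_zero' := LocalizedEnd.mk_congr fun x => by
    obtain ⟨x, rfl⟩ := Submodule.Quotient.mk_surjective _ x
    rw [leftMul_mk, op_zero, mul_zero]; rfl
  map_add' r s := LocalizedEnd.mk_congr fun x => by
    obtain ⟨x, rfl⟩ := Submodule.Quotient.mk_surjective _ x
    change _ = leftMul G r _ + leftMul G s _
    rw [leftMul_mk, leftMul_mk, leftMul_mk, op_add, mul_add]; rfl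

/-- `Q_G` as a left `R`-module through `λ_G`. -/
instance : Module R (QuotientRing G) := Module.compHom _ (toQuotientRing G)

/-- `Q_G` as a right `R`-module through `λ_G`. -/
instance : Module Rᵐᵒᵖ (QuotientRing G) :=
  Module.compHom _ (toQuotientRing G).op

variable {G}

theorem torsionFreeQuotient_eq_zero {I : Ideal Rᵐᵒᵖ} (hI : I ∈ G) {n : TorsionFreeQuotient G}
    (h : ∀ a ∈ I, a • n = 0) : n = 0 := by
  obtain ⟨s, rfl⟩ := Submodule.Quotient.mk_surjective _ n
  rw [Submodule.Quotient.mk_eq_zero]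
  refine ⟨(⊥ : Ideal Rᵐᵒᵖ).colon {s}, IdealFilter.IsGabriel.gabriel_closed _ ⟨I, hI, ?_⟩, ?_⟩
  · intro a ha
    have := h a ha
    rw [← Submodule.Quotient.mk_smul, Submodule.Quotient.mk_eq_zero] at this
    obtain ⟨L, hL, h'⟩ := this
    refine Order.PFilter.mem_of_le (fun b hb => ?_) hL
    rw [Submodule.mem_colon_singleton, Submodule.mem_colon_singleton, smul_assoc]
    exact h' b hb
  · intro a ha
    simpa [Submodule.mem_colon_singleton] using ha

theorem toQuotientRing_eq_zero {s : Rᵐᵒᵖ} (h : toQuotientRing G (unop s) = 0) :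
    (Submodule.Quotient.mk s : TorsionFreeQuotient G) = 0 := by
  obtain ⟨D, hD, h⟩ := LocalizedEnd.mk_eq_mk.1 h
  refine torsionFreeQuotient_eq_zero (hD (Submodule.Quotient.mk 1)) fun a ha => ?_
  rw [Submodule.mem_colon_singleton] at ha
  have := h _ ha
  rw [← Submodule.Quotient.mk_smul, leftMul_mk, smul_eq_mul, mul_one, ← smul_eq_mul,
    op_unop, Submodule.Quotient.mk_smul] at this
  exact this

theorem smul_mk {f : TorsionFreeQuotient G → TorsionFreeQuotient G}
    {D : Submodule Rᵐᵒᵖ (TorsionFreeQuotient G)} (hD : IsDense G D) (hf : IsLinearOn D f)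
    {a s : Rᵐᵒᵖ} (ha : Submodule.Quotient.mk a ∈ D)
    (hs : f (Submodule.Quotient.mk a) = Submodule.Quotient.mk s) :
    a • (LocalizedEnd.mk f ⟨D, hD, hf⟩ : QuotientRing G) = toQuotientRing G (unop s) := by
  refine LocalizedEnd.mk_congr fun x => ?_
  obtain ⟨x, rfl⟩ := Submodule.Quotient.mk_surjective _ x
  change f (leftMul G (unop a) _) = leftMul G (unop s) _
  rw [leftMul_mk, leftMul_mk, op_unop, op_unop, ← smul_eq_mul, Submodule.Quotient.mk_smul,
    hf.2 _ _ ha, hs]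
  rfl

theorem smul_toQuotientRing (a s : Rᵐᵒᵖ) :
    a • toQuotientRing G (unop s) = toQuotientRing G (unop (a * s)) :=
  (map_mul (toQuotientRing G) (unop s) (unop a)).symm

theorem exists_smul_eq (q : QuotientRing G) :
    ∃ J ∈ G, ∀ a ∈ J, ∃ s : Rᵐᵒᵖ, a • q = toQuotientRing G (unop s) := by
  induction q using LocalizedEnd.ind with | _ f hf
  obtain ⟨D, hD, hf⟩ := hf
  refine ⟨_, hD (Submodule.Quotient.mk 1), fun a ha => ?_⟩
  rw [Submodule.mem_colon_singleton, ← Submodule.Quotient.mk_smul, smul_eq_mul, mul_one] at ha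
  obtain ⟨s, hs⟩ := Submodule.Quotient.mk_surjective _ (f (Submodule.Quotient.mk a))
  exact ⟨s, smul_mk hD hf ha hs.symm⟩

theorem quotientRing_eq_zero {I : Ideal Rᵐᵒᵖ} (hI : I ∈ G) {q : QuotientRing G}
    (h : ∀ a ∈ I, a • q = 0) : q = 0 := by
  induction q using LocalizedEnd.ind with | _ f hf
  obtain ⟨D, hD, hf⟩ := hf
  let J := I ⊓ D.colon {Submodule.Quotient.mk 1}
  have hJ : J ∈ G := Order.PFilter.inf_mem hI (hD _)
  refine LocalizedEnd.mk_eq_mk.2 ⟨Submodule.map (Submodule.mkQ _) J, fun n => ?_, ?_⟩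
  · obtain ⟨x, rfl⟩ := Submodule.Quotient.mk_surjective _ n
    refine Order.PFilter.mem_of_le (fun b hb => ?_) (IdealFilter.IsUniform.colon_mem hJ x)
    rw [Submodule.mem_colon_singleton] at hb ⊢
    exact ⟨_, hb, rfl⟩
  · rintro _ ⟨a, ⟨haI, haD⟩, rfl⟩
    rw [SetLike.mem_coe, Submodule.mem_colon_singleton, ← Submodule.Quotient.mk_smul,
      smul_eq_mul, mul_one] at haD
    obtain ⟨s, hs⟩ := Submodule.Quotient.mk_surjective _ (f (Submodule.Quotient.mk a))
    have h1 := smul_mk hD hf haD hs.symm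
    rw [h a haI] at h1
    exact hs.symm.trans (toQuotientRing_eq_zero h1.symm)

variable (G) in
/-- `Q_G` is a `G`-closed right `R`-module. -/
theorem isGClosed_quotientRing : IsGClosed G (QuotientRing G) := by
  classical
  intro I hI
  constructor
  · intro g g' h
    ext
    rw [← sub_eq_zero]
    refine quotientRing_eq_zero hI fun a ha => ?_
    have := LinearMap.congr_fun h ⟨a, ha⟩
    simp only [LinearMap.domRestrict_apply] at this
    rw [smul_sub, ← map_smul, ← map_smul, smul_eq_mul, mul_one, this, sub_self]
  intro h
  let D : Submodule Rᵐᵒᵖ (TorsionFreeQuotient G) :=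
    { carrier := {n | ∃ (x : I) (s : Rᵐᵒᵖ), (torsionSubmodule G Rᵐᵒᵖ).mkQ x = n ∧
        h x = toQuotientRing G (unop s)}
      add_mem' := by
        rintro _ _ ⟨x, s, rfl, hx⟩ ⟨y, t, rfl, hy⟩
        exact ⟨x + y, s + t, rfl, by rw [map_add, hx, hy, unop_add, map_add]⟩
      zero_mem' := ⟨0, 0, rfl, by simp⟩
      smul_mem' := by
        rintro a _ ⟨x, s, rfl, hx⟩
        exact ⟨a • x, a * s, rfl, by rw [map_smul, hx, smul_toQuotientRing]⟩ }
  have key : ∀ (x y : I) (s t : Rᵐᵒᵖ),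
      (torsionSubmodule G Rᵐᵒᵖ).mkQ x = (torsionSubmodule G Rᵐᵒᵖ).mkQ y →
      h x = toQuotientRing G (unop s) → h y = toQuotientRing G (unop t) →
      (Submodule.Quotient.mk s : TorsionFreeQuotient G) = Submodule.Quotient.mk t := by
    intro x y s t hxy hx hy
    rw [Submodule.mkQ_apply, Submodule.mkQ_apply, Submodule.Quotient.eq] at hxy
    obtain ⟨L, hL, h'⟩ := hxy
    have h0 : h (x - y) = 0 := quotientRing_eq_zero hL fun a ha => by
      rw [← map_smul, (Subtype.ext (h' a ha) : a • (x - y) = 0), map_zero]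
    rw [← sub_eq_zero, ← Submodule.Quotient.mk_sub]
    apply toQuotientRing_eq_zero
    rw [unop_sub, map_sub, ← hx, ← hy, ← map_sub, h0]
  let f : TorsionFreeQuotient G → TorsionFreeQuotient G := fun n =>
    if hn : n ∈ D then Submodule.Quotient.mk hn.choose_spec.choose else 0
  have hf : ∀ (x : I) (s : Rᵐᵒᵖ), h x = toQuotientRing G (unop s) →
      f ((torsionSubmodule G Rᵐᵒᵖ).mkQ x) = Submodule.Quotient.mk s := by
    intro x s hx
    have hn : (torsionSubmodule G Rᵐᵒᵖ).mkQ x ∈ D := ⟨x, s, rfl, hx⟩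
    simp only [f, dif_pos hn]
    exact key _ x _ _ hn.choose_spec.choose_spec.1 hn.choose_spec.choose_spec.2 hx
  have hlin : IsLinearOn D f := by
    constructor
    · rintro _ ⟨x, s, rfl, hx⟩ _ ⟨y, t, rfl, hy⟩
      rw [hf x s hx, hf y t hy]
      exact hf (x + y) (s + t) (by rw [map_add, hx, hy, unop_add, map_add])
    · rintro a _ ⟨x, s, rfl, hx⟩
      rw [hf x s hx]
      exact hf (a • x) (a * s) (by rw [map_smul, hx, smul_toQuotientRing])
  have hD : IsDense G D := by
    intro n
    obtain ⟨y, rfl⟩ := Submodule.Quotient.mk_surjective _ n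
    refine IdealFilter.IsGabriel.gabriel_closed _
      ⟨I.colon {y}, IdealFilter.IsUniform.colon_mem hI y, fun a ha => ?_⟩
    rw [Submodule.mem_colon_singleton] at ha
    obtain ⟨J, hJ, hs⟩ := exists_smul_eq (h ⟨a • y, ha⟩)
    refine Order.PFilter.mem_of_le (fun b hb => ?_) hJ
    rw [Submodule.mem_colon_singleton, Submodule.mem_colon_singleton, smul_assoc]
    obtain ⟨s, hs⟩ := hs b hb
    exact ⟨b • ⟨a • y, ha⟩, s, rfl, by rw [map_smul, hs]⟩
  refine ⟨LinearMap.toSpanSingleton _ _ (LocalizedEnd.mk f ⟨D, hD, hlin⟩), ?_⟩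
  ext x
  rw [LinearMap.domRestrict_apply, LinearMap.toSpanSingleton_apply, ← sub_eq_zero]
  obtain ⟨J, hJ, hs⟩ := exists_smul_eq (h x)
  refine quotientRing_eq_zero hJ fun b hb => ?_
  obtain ⟨s, hs⟩ := hs b hb
  have hbx : h (b • x) = toQuotientRing G (unop s) := by rw [map_smul, hs]
  rw [smul_sub, hs, sub_eq_zero, ← smul_assoc]
  exact smul_mk hD hlin ⟨b • x, s, rfl, hbx⟩ (hf _ s hbx)

variable (G) in
/-- `λ_G : R → Q_G` is the reflection of the right module `R` in the `G`-closed modules. -/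
theorem existsUnique_extension {C : Type v} [AddCommGroup C] [Module Rᵐᵒᵖ C]
    (hC : IsGClosed G C) (g : R →ₗ[Rᵐᵒᵖ] C) :
    ∃! h : QuotientRing G →ₗ[Rᵐᵒᵖ] C, ∀ r, h (toQuotientRing G r) = g r := by
  have hg : ∀ a s : Rᵐᵒᵖ, a • g (unop s) = g (unop (a * s)) := fun a s =>
    (map_smul g a (unop s)).symm
  have hker : ∀ s : Rᵐᵒᵖ, toQuotientRing G (unop s) = 0 → g (unop s) = 0 := by
    intro s hs
    have := toQuotientRing_eq_zero hs
    rw [Submodule.Quotient.mk_eq_zero] at this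
    obtain ⟨L, hL, h⟩ := this
    refine hC.eq_zero hL fun a ha => ?_
    rw [hg, ← smul_eq_mul, h a ha, unop_zero, map_zero]
  let H : QuotientRing G → C → Prop := fun q c =>
    ∃ J ∈ G, ∀ a ∈ J, ∃ s : Rᵐᵒᵖ, a • q = toQuotientRing G (unop s) ∧ a • c = g (unop s)
  have huniq : ∀ q c c', H q c → H q c' → c = c' := by
    rintro q c c' ⟨J, hJ, h⟩ ⟨J', hJ', h'⟩
    rw [← sub_eq_zero]
    refine hC.eq_zero (Order.PFilter.inf_mem hJ hJ') fun a ha => ?_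
    obtain ⟨s, hs, hs'⟩ := h a ha.1
    obtain ⟨t, ht, ht'⟩ := h' a ha.2
    rw [smul_sub, hs', ht', ← map_sub, ← unop_sub]
    apply hker
    rw [unop_sub, map_sub, ← hs, ← ht, sub_self]
  have hex : ∀ q, ∃ c, H q c := by
    intro q
    obtain ⟨J, hJ, hs⟩ := exists_smul_eq q
    choose s hs using hs
    have hwd : ∀ t t' : Rᵐᵒᵖ, toQuotientRing G (unop t) = toQuotientRing G (unop t') →
        g (unop t) = g (unop t') := by
      intro t t' h
      rw [← sub_eq_zero, ← map_sub, ← unop_sub]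
      apply hker
      rw [unop_sub, map_sub, h, sub_self]
    let k : J →ₗ[Rᵐᵒᵖ] C :=
      { toFun := fun a => g (unop (s a a.2))
        map_add' := fun a b => by
          rw [← map_add, ← unop_add]
          apply hwd
          rw [← hs, unop_add, map_add, ← hs, ← hs]
          exact add_smul _ _ _
        map_smul' := fun a b => by
          rw [RingHom.id_apply, hg]
          apply hwd
          rw [← hs, ← smul_toQuotientRing, ← hs]
          exact mul_smul _ _ _ }
    obtain ⟨l, hl⟩ := (hC J hJ).2 k
    refine ⟨l 1, J, hJ, fun a ha => ⟨s a ha, hs a ha, ?_⟩⟩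
    have := LinearMap.congr_fun hl ⟨a, ha⟩
    rw [← map_smul, smul_eq_mul, mul_one]
    exact this
  choose h hh using hex
  refine ⟨{ toFun := h, map_add' := fun q q' => ?_, map_smul' := fun r q => ?_ }, ?_, ?_⟩
  · refine huniq _ _ _ (hh _) ?_
    obtain ⟨J, hJ, h1⟩ := hh q
    obtain ⟨J', hJ', h2⟩ := hh q'
    refine ⟨J ⊓ J', Order.PFilter.inf_mem hJ hJ', fun a ha => ?_⟩
    obtain ⟨s, hs, hs'⟩ := h1 a ha.1
    obtain ⟨t, ht, ht'⟩ := h2 a ha.2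
    exact ⟨s + t, by rw [smul_add, hs, ht, unop_add, map_add],
      by rw [smul_add, hs', ht', unop_add, map_add]⟩
  · refine huniq _ _ _ (hh _) ?_
    obtain ⟨J, hJ, h1⟩ := hh q
    refine ⟨J.colon {r}, IdealFilter.IsUniform.colon_mem hJ r, fun a ha => ?_⟩
    rw [Submodule.mem_colon_singleton] at ha
    obtain ⟨s, hs, hs'⟩ := h1 _ ha
    exact ⟨s, by rw [← hs, smul_assoc], by rw [← hs', RingHom.id_apply, smul_assoc]⟩
  · intro r
    obtain ⟨J, hJ⟩ := G.nonempty
    exact huniq _ _ _ (hh _) ⟨J, hJ, fun a _ => ⟨a * op r, smul_toQuotientRing a (op r),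
      hg a (op r)⟩⟩
  · intro h' hh'
    ext q
    refine huniq _ _ _ ?_ (hh q)
    obtain ⟨J, hJ, hs⟩ := exists_smul_eq q
    refine ⟨J, hJ, fun a ha => ?_⟩
    obtain ⟨s, hs⟩ := hs a ha
    exact ⟨s, hs, by rw [← map_smul, hs, hh']⟩

variable (G) in
/-- `G` is perfect if the left `R`-module `Q_G` is `G`-divisible. -/
def IsPerfect : Prop := IsGDivisible G (QuotientRing G)

end QuotientRing

section TorsionPair

variable {R : Type u} [Ring R]

/-- `(T, F)` is a hereditary torsion pair of right `R`-modules. -/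
structure IsHereditaryTorsionPair (T F : CategoryTheory.ObjectProperty (ModuleCat.{u} Rᵐᵒᵖ)) :
    Prop where
  torsion_iff : ∀ M, T M ↔ ∀ N, F N → ∀ f : M →ₗ[Rᵐᵒᵖ] N, f = 0
  torsionFree_iff : ∀ N, F N ↔ ∀ M, T M → ∀ f : M →ₗ[Rᵐᵒᵖ] N, f = 0
  submodule : ∀ M, T M → ∀ K : Submodule Rᵐᵒᵖ M, T (ModuleCat.of Rᵐᵒᵖ K)

/-- The torsion class `T` corresponds to `G`: `G` consists of the right ideals `I` of `R` with
`R / I ∈ T`. -/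
def CorrespondsTo (G : IdealFilter Rᵐᵒᵖ) (T : CategoryTheory.ObjectProperty (ModuleCat.{u} Rᵐᵒᵖ)) :
    Prop :=
  ∀ I : Ideal Rᵐᵒᵖ, I ∈ G ↔ T (ModuleCat.of Rᵐᵒᵖ (Rᵐᵒᵖ ⧸ I))

/-- The class of all finitely presented modules in `T`. -/
def finitelyPresentedIn (T : CategoryTheory.ObjectProperty (ModuleCat.{u} Rᵐᵒᵖ)) :
    CategoryTheory.ObjectProperty (ModuleCat.{u} Rᵐᵒᵖ) :=
  fun M => T M ∧ Module.FinitePresentation Rᵐᵒᵖ M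

variable (R) in
/-- Every finitely generated right ideal of `R` is projective. -/
def IsRightSemihereditary : Prop :=
  ∀ I : Ideal Rᵐᵒᵖ, I.FG → Module.Projective Rᵐᵒᵖ I

end TorsionPair

section UniversalLocalization

variable {R S : Type u} [Ring R] [Ring S] (lam : R →+* S)

/-- The right `S`-submodule of `S ⊗_ℤ P` generated by the elements
`(λ(r) s) ⊗ p - s ⊗ (p r)`. -/
def balancingSubmodule (P : Type u) [AddCommGroup P] [Module Rᵐᵒᵖ P] :
    Submodule Sᵐᵒᵖ (S ⊗[ℤ] P) :=
  Submodule.span Sᵐᵒᵖ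
    {t | ∃ (s : S) (r : R) (p : P), t = (lam r * s) ⊗ₜ[ℤ] p - s ⊗ₜ[ℤ] (op r • p)}

/-- The right `S`-module `P ⊗_R S`, for a right `R`-module `P` and a ring homomorphism
`λ : R → S`.  The element `p ⊗ s` is the class of `s ⊗ₜ[ℤ] p`. -/
abbrev BaseChange (P : Type u) [AddCommGroup P] [Module Rᵐᵒᵖ P] : Type u :=
  (S ⊗[ℤ] P) ⧸ balancingSubmodule lam P

/-- The right `S`-linear map `α ⊗_R S : P ⊗_R S → Q ⊗_R S`. -/
def baseChangeMap {P Q : Type u} [AddCommGroup P] [Module Rᵐᵒᵖ P] [AddCommGroup Q]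
    [Module Rᵐᵒᵖ Q] (α : P →ₗ[Rᵐᵒᵖ] Q) : BaseChange lam P →ₗ[Sᵐᵒᵖ] BaseChange lam Q :=
  Submodule.mapQ _ _
    (TensorProduct.AlgebraTensorModule.lTensor Sᵐᵒᵖ S α.toAddMonoidHom.toIntLinearMap) (by
      rw [balancingSubmodule, Submodule.span_le]
      rintro _ ⟨s, r, p, rfl⟩
      refine Submodule.subset_span ⟨s, r, α p, ?_⟩
      simp)

/-- `λ` inverts all morphisms in `W`. -/
def IsInverting (W : CategoryTheory.MorphismProperty (ModuleCat.{u} Rᵐᵒᵖ)) : Prop :=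
  ∀ ⦃P Q : ModuleCat.{u} Rᵐᵒᵖ⦄ (α : P ⟶ Q), W α → Function.Bijective (baseChangeMap lam α.hom)

/-- `λ` is a universal localization of `R` at the class `W` of morphisms. -/
def IsUniversalLocalization (W : CategoryTheory.MorphismProperty (ModuleCat.{u} Rᵐᵒᵖ)) : Prop :=
  IsInverting lam W ∧ ∀ (T : Type u) [Ring T] (ψ : R →+* T), IsInverting ψ W →
    ∃! φ : S →+* T, φ.comp lam = ψ

/-- `W` consists of monomorphisms `α : P → Q` between finitely generated projective right
`R`-modules which have a cokernel in `C`, and every `U ∈ C` has a resolution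
`0 → P → Q → U → 0` with `P → Q` in `W`. -/
structure IsResolvingFor (W : CategoryTheory.MorphismProperty (ModuleCat.{u} Rᵐᵒᵖ))
    (C : CategoryTheory.ObjectProperty (ModuleCat.{u} Rᵐᵒᵖ)) : Prop where
  of_mem : ∀ ⦃P Q : ModuleCat.{u} Rᵐᵒᵖ⦄ (α : P ⟶ Q), W α →
    (Module.Finite Rᵐᵒᵖ P ∧ Module.Projective Rᵐᵒᵖ P) ∧
    (Module.Finite Rᵐᵒᵖ Q ∧ Module.Projective Rᵐᵒᵖ Q) ∧
    Function.Injective α.hom ∧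
    ∃ U, C U ∧ ∃ β : Q ⟶ U, Function.Surjective β.hom ∧ Function.Exact α.hom β.hom
  exists_resolution : ∀ U, C U → ∃ (P Q : ModuleCat.{u} Rᵐᵒᵖ) (α : P ⟶ Q) (β : Q ⟶ U),
    W α ∧ Function.Surjective β.hom ∧ Function.Exact α.hom β.hom

/-- `λ` is a universal localization of `R` at the class `C` of right modules, that is, at a class
of morphisms formed by projective resolutions `0 → P → Q → U → 0` of the modules `U ∈ C`. -/
def IsUniversalLocalizationAt (C : CategoryTheory.ObjectProperty (ModuleCat.{u} Rᵐᵒᵖ)) : Prop :=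
  ∃ W, IsResolvingFor W C ∧ IsUniversalLocalization lam W

/-- `λ : R → S` is an epimorphism in the category of rings. -/
def IsRingEpimorphism : Prop := CategoryTheory.Epi (RingCat.ofHom lam)

/-- `λ : R → S` and `λ' : R → S'` are equivalent: `λ' = φ λ` for a ring isomorphism `φ`. -/
def AreEquivalent {S' : Type u} [Ring S'] (lam' : R →+* S') : Prop :=
  ∃ φ : S ≃+* S', lam' = φ.toRingHom.comp lam

end UniversalLocalization

end PerfectLocalization

/-!
For a map `α : P → N` of finitely generated projective modules, `α ⊗_R S` is an isomorphism if and
only if its dual `Hom_R(N, S) → Hom_R(P, S)` is one, that is, if and only if the right `R`-module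
`S` is local with respect to `α`. If `α` is injective with torsion cokernel, every `G`-closed module
is local with respect to `α`; in particular `Q_G` inverts the resolutions of the modules in the
class. Conversely, let `R → S` be a ring homomorphism inverting them. Locality depends only on the
module which is resolved, so `S` is local with respect to the inclusions `J → R` of all right ideals
`J ∈ G` with `R / J` in the class. As these are cofinal in `G`, the right module `S` is `G`-closed,
and the reflection property of `Q_G` yields a unique factorization `Q_G → S` of right modules, which
is a ring homomorphism. Perfectness of `G` provides the cofinal finitely generated right ideals, and
semihereditariness of `R` the resolutions.
-/

namespace PerfectLocalization

section IsLocal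

variable {A P N X : Type*} [Ring A] [AddCommGroup P] [Module A P] [AddCommGroup N] [Module A N]
  [AddCommGroup X] [Module A X] {α : P →ₗ[A] N}

/-- The module `X` is local with respect to `α : P → N` if every map `P → X` extends uniquely
along `α`. Thus a module is `G`-closed if it is local with respect to the inclusions `I → A` of
all `I ∈ G`. -/
def IsLocal (α : P →ₗ[A] N) (X : Type*) [AddCommGroup X] [Module A X] : Prop :=
  Function.Bijective fun g : N →ₗ[A] X => g ∘ₗ α

theorem isLocal_iff : IsLocal α X ↔
    (∀ g : N →ₗ[A] X, g ∘ₗ α = 0 → g = 0) ∧ ∀ h : P →ₗ[A] X, ∃ g : N →ₗ[A] X, g ∘ₗ α = h :=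
  and_congr_left' (injective_iff_map_eq_zero (LinearMap.lcomp ℕ X α))

theorem isLocal_of_bijective (hα : Function.Bijective α) : IsLocal α X := by
  refine ⟨fun g g' h => (LinearMap.cancel_right hα.2).1 h, fun h => ?_⟩
  exact ⟨h ∘ₗ (LinearEquiv.ofBijective α hα).symm,
    LinearMap.ext fun p => congrArg h ((LinearEquiv.ofBijective α hα).symm_apply_apply p)⟩

namespace IsLocal

theorem of_comp_eq_id {Y : Type*} [AddCommGroup Y] [Module A Y] {i : Y →ₗ[A] X} {r : X →ₗ[A] Y}
    (hri : r ∘ₗ i = LinearMap.id) (hX : IsLocal α X) : IsLocal α Y := by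
  constructor
  · intro g g' h
    have hi : i ∘ₗ g = i ∘ₗ g' := hX.1 (congrArg (i ∘ₗ ·) h)
    exact (LinearMap.cancel_left (LinearMap.injective_of_comp_eq_id _ _ hri)).1 hi
  · intro h
    obtain ⟨g, hg⟩ := hX.2 (i ∘ₗ h)
    refine ⟨r ∘ₗ g, ?_⟩
    calc (r ∘ₗ g) ∘ₗ α = r ∘ₗ i ∘ₗ h := congrArg (r ∘ₗ ·) hg
      _ = h := by rw [← LinearMap.comp_assoc, hri, LinearMap.id_comp]

theorem pi {ι : Type*} (hX : IsLocal α X) : IsLocal α (ι → X) := by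
  constructor
  · intro g g' h
    ext n i
    have hi : LinearMap.proj i ∘ₗ g = LinearMap.proj i ∘ₗ g' :=
      hX.1 (congrArg (LinearMap.proj i ∘ₗ ·) h)
    exact LinearMap.congr_fun hi n
  · intro h
    choose g hg using fun i => hX.2 (LinearMap.proj i ∘ₗ h)
    exact ⟨LinearMap.pi g, LinearMap.ext fun p => funext fun i => LinearMap.congr_fun (hg i) p⟩

theorem of_finite_of_projective [Module.Finite A X] [Module.Projective A X] (h : IsLocal α A) :
    IsLocal α X := by
  obtain ⟨_, _, _, -, -, hfg⟩ := Module.Finite.exists_comp_eq_id_of_projective A X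
  exact h.pi.of_comp_eq_id hfg

end IsLocal

theorem isLocal_self_iff [Module.Finite A P] [Module.Projective A P] [Module.Finite A N]
    [Module.Projective A N] : IsLocal α A ↔ Function.Bijective α := by
  refine ⟨fun h => ?_, isLocal_of_bijective⟩
  have hP : IsLocal α P := h.of_finite_of_projective
  have hN : IsLocal α N := h.of_finite_of_projective
  obtain ⟨g, hgα⟩ := hP.2 LinearMap.id
  have hαg : α ∘ₗ g = LinearMap.id := hN.1 (congrArg (α ∘ₗ ·) hgα)
  exact Function.bijective_iff_has_inverse.2
    ⟨g, LinearMap.congr_fun hgα, LinearMap.congr_fun hαg⟩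

theorem exists_lift_of_exact {U M : Type*} [AddCommGroup U] [Module A U] [AddCommGroup M]
    [Module A M] {β : N →ₗ[A] U} (hα : Function.Injective α) (hex : Function.Exact α β)
    (f : M →ₗ[A] N) (hf : ∀ m, β (f m) = 0) : ∃ u : M →ₗ[A] P, ∀ m, α (u m) = f m :=
  have hrange : ∀ m, f m ∈ LinearMap.range α := fun m => (hex _).1 (hf m)
  let e := LinearEquiv.ofInjective α hα
  ⟨e.symm ∘ₗ f.codRestrict _ hrange, fun m =>
    congrArg Subtype.val (e.apply_symm_apply ⟨f m, hrange m⟩)⟩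

/-- As in Schanuel's lemma, lifting the identity of `U` yields maps `b : N → N'` and `c : N' → N`
such that `1 - b ∘ c` factors through `α'`. -/
theorem IsLocal.of_exact {P' N' U : Type*} [AddCommGroup P'] [Module A P'] [AddCommGroup N']
    [Module A N'] [AddCommGroup U] [Module A U] [Module.Projective A N] [Module.Projective A N']
    {β : N →ₗ[A] U} {α' : P' →ₗ[A] N'} {β' : N' →ₗ[A] U} (hα' : Function.Injective α')
    (hex : Function.Exact α β) (hβ : Function.Surjective β)
    (hex' : Function.Exact α' β') (hβ' : Function.Surjective β') (hX : IsLocal α X) :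
    IsLocal α' X := by
  obtain ⟨b, hb⟩ := Module.projective_lifting_property β' β hβ'
  obtain ⟨c, hc⟩ := Module.projective_lifting_property β β' hβ
  have hb : ∀ n, β' (b n) = β n := LinearMap.congr_fun hb
  have hc : ∀ n', β (c n') = β' n' := LinearMap.congr_fun hc
  obtain ⟨u, hu⟩ := exists_lift_of_exact hα' hex' (b ∘ₗ α) fun p => by
    rw [LinearMap.comp_apply, hb, hex.apply_apply_eq_zero]
  obtain ⟨v, hv⟩ := exists_lift_of_exact hα' hex' (LinearMap.id - b ∘ₗ c) fun n' => by
    simp [hb, hc]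
  replace hu : ∀ p, α' (u p) = b (α p) := hu
  replace hv : ∀ n', α' (v n') = n' - b (c n') := hv
  rw [isLocal_iff] at hX ⊢
  constructor
  · intro g hg
    have hgα' : ∀ p', g (α' p') = 0 := LinearMap.congr_fun hg
    have hgb : g ∘ₗ b = 0 := hX.1 _ (LinearMap.ext fun p =>
      (congrArg g (hu p)).symm.trans (hgα' (u p)))
    ext n'
    calc g n' = g (α' (v n')) + g (b (c n')) := by rw [hv, map_sub, sub_add_cancel]
      _ = 0 := by rw [hgα', zero_add]; exact LinearMap.congr_fun hgb _
  · intro h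
    obtain ⟨g, hg⟩ := hX.2 (h ∘ₗ u)
    refine ⟨g ∘ₗ c + h ∘ₗ v, LinearMap.ext fun p' => ?_⟩
    obtain ⟨p, hp⟩ := (hex (c (α' p'))).1 (by rw [hc, hex'.apply_apply_eq_zero])
    have hp' : u p + v (α' p') = p' := hα' (by
      rw [map_add, hu, hv, hp, add_sub_cancel])
    calc g (c (α' p')) + h (v (α' p')) = h (u p) + h (v (α' p')) := by
          rw [← hp]; exact congrArg (· + _) (LinearMap.congr_fun hg p)
      _ = h p' := by rw [← map_add, hp']

end IsLocal

section ProjectiveDimension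

variable {A : Type u} [Ring A]

open CategoryTheory in
theorem hasProjectiveDimensionLE_one_iff_projective_ker {M U : ModuleCat.{u} A}
    [Module.Projective A M] {f : M →ₗ[A] U} (hf : Function.Surjective f) :
    HasProjectiveDimensionLE U 1 ↔ Module.Projective A (LinearMap.ker f) := by
  rw [IsProjective.iff_projective, projective_iff_hasProjectiveDimensionLT_one]
  exact (LinearMap.shortExact_shortComplexKer hf).hasProjectiveDimensionLT_X₃_iff 0
    ((IsProjective.iff_projective M).1 inferInstance)

theorem projective_of_projective_ker_of_projective_range {M N : Type*} [AddCommGroup M]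
    [Module A M] [AddCommGroup N] [Module A N] (p : M →ₗ[A] N)
    [Module.Projective A (LinearMap.ker p)] [Module.Projective A (LinearMap.range p)] :
    Module.Projective A M := by
  obtain ⟨s, hs⟩ := p.rangeRestrict.exists_rightInverse_of_surjective p.range_rangeRestrict
  have hex : Function.Exact (LinearMap.ker p).subtype p.rangeRestrict := by
    rw [← p.ker_rangeRestrict]
    exact p.rangeRestrict.exact_subtype_ker_map
  let e := (hex.splitSurjectiveEquiv (LinearMap.ker p).injective_subtype ⟨s, hs⟩).1
  exact .of_equiv e.symm

theorem projective_of_injective (hA : ∀ I : Ideal A, I.FG → Module.Projective A I) {n : ℕ}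
    {M : Type v} [AddCommGroup M] [Module A M] [Module.Finite A M] {f : M →ₗ[A] Fin n → A}
    (hf : Function.Injective f) : Module.Projective A M := by
  induction n generalizing M with
  | zero =>
    have : Subsingleton M := hf.subsingleton
    infer_instance
  | succ n ih =>
    let p : M →ₗ[A] A := LinearMap.proj 0 ∘ₗ f
    let q : M →ₗ[A] Fin n → A := LinearMap.funLeft A A Fin.succ ∘ₗ f
    have : Module.Projective A (LinearMap.range p) := hA _ (Module.Finite.iff_fg.1 inferInstance)
    have : Module.FinitePresentation A (LinearMap.range p) :=
      Module.finitePresentation_of_projective A _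
    have : Module.Finite A (LinearMap.ker p) := .of_fg <| by
      rw [← p.ker_rangeRestrict]
      exact Module.FinitePresentation.fg_ker _ p.surjective_rangeRestrict
    have hq : Function.Injective (q ∘ₗ (LinearMap.ker p).subtype) := by
      intro x y hxy
      refine Subtype.ext (hf (funext (Fin.cases ?_ (congrFun hxy))))
      exact x.2.trans y.2.symm
    have : Module.Projective A (LinearMap.ker p) := ih hq
    exact projective_of_projective_ker_of_projective_range p

end ProjectiveDimension

section BaseChange

variable {R S : Type u} [Ring R] [Ring S] {lam : R →+* S}
  {P N : Type u} [AddCommGroup P] [Module Rᵐᵒᵖ P] [AddCommGroup N] [Module Rᵐᵒᵖ N]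

namespace BaseChange

variable (lam P) in
/-- The canonical map `P → P ⊗_R S`, `p ↦ p ⊗ 1`. -/
def of : P →+ BaseChange lam P :=
  (balancingSubmodule lam P).mkQ.toAddMonoidHom.comp (TensorProduct.mk ℤ S P 1).toAddMonoidHom

theorem op_smul_of (s : S) (p : P) :
    op s • of lam P p = Submodule.Quotient.mk (s ⊗ₜ[ℤ] p) := by
  change Submodule.Quotient.mk ((1 * s) ⊗ₜ[ℤ] p) = _
  rw [one_mul]

theorem of_op_smul (r : R) (p : P) : of lam P (op r • p) = op (lam r) • of lam P p := by
  have h : (lam r * 1) ⊗ₜ[ℤ] p - 1 ⊗ₜ[ℤ] (op r • p) ∈ balancingSubmodule lam P :=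
    Submodule.subset_span ⟨1, r, p, rfl⟩
  rw [mul_one] at h
  rw [op_smul_of]
  exact ((Submodule.Quotient.eq _).2 h).symm

theorem span_range_of : Submodule.span Sᵐᵒᵖ (Set.range (of lam P)) = ⊤ := by
  refine Submodule.eq_top_iff'.2 fun x => ?_
  obtain ⟨t, rfl⟩ := Submodule.Quotient.mk_surjective _ x
  induction t with
  | zero => exact Submodule.zero_mem _
  | tmul s p =>
    rw [← op_smul_of]
    exact Submodule.smul_mem _ _ (Submodule.subset_span ⟨p, rfl⟩)
  | add t t' ht ht' => exact Submodule.add_mem _ ht ht'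

theorem hom_ext {X : Type*} [AddCommGroup X] [Module Sᵐᵒᵖ X] {f g : BaseChange lam P →ₗ[Sᵐᵒᵖ] X}
    (h : ∀ p, f (of lam P p) = g (of lam P p)) : f = g :=
  LinearMap.ext_on_range span_range_of h

theorem baseChangeMap_of (α : P →ₗ[Rᵐᵒᵖ] N) (p : P) :
    baseChangeMap lam α (of lam P p) = of lam N (α p) := rfl

section Lift

variable {X : Type*} [AddCommGroup X] [Module Rᵐᵒᵖ X] [Module Sᵐᵒᵖ X]
  (hX : ∀ (r : R) (x : X), op r • x = op (lam r) • x)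

/-- The right `S`-linear map `P ⊗_R S → X`, `p ⊗ s ↦ g(p) s`, induced by a right `R`-linear map
`g : P → X` into a right `S`-module `X`. -/
def lift (g : P →ₗ[Rᵐᵒᵖ] X) : BaseChange lam P →ₗ[Sᵐᵒᵖ] X :=
  Submodule.liftQ _
    (TensorProduct.AlgebraTensorModule.lift
      { toFun := fun s => ((DistribSMul.toAddMonoidHom X (op s)).comp g).toIntLinearMap
        map_add' := fun s s' => by ext p; simp [add_smul]
        map_smul' := fun t s => by ext p; simp [mul_smul] }) (by
    rw [balancingSubmodule, Submodule.span_le]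
    rintro _ ⟨s, r, p, rfl⟩
    simp [hX, mul_smul])

theorem lift_of (g : P →ₗ[Rᵐᵒᵖ] X) (p : P) : lift hX g (of lam P p) = g p :=
  one_smul Sᵐᵒᵖ (g p)

/-- The adjunction between extension and restriction of scalars along `lam`. -/
def liftEquiv : (P →ₗ[Rᵐᵒᵖ] X) ≃ (BaseChange lam P →ₗ[Sᵐᵒᵖ] X) where
  toFun := lift hX
  invFun f :=
    { toFun := fun p => f (of lam P p)
      map_add' := fun p p' => by rw [map_add, map_add]
      map_smul' := fun r p => by
        rw [← op_unop r, of_op_smul, map_smul, RingHom.id_apply, hX] }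
  left_inv g := LinearMap.ext fun p => lift_of hX g p
  right_inv _ := hom_ext fun _ => lift_of hX _ _

include hX in
theorem isLocal_baseChangeMap_iff {α : P →ₗ[Rᵐᵒᵖ] N} :
    IsLocal (baseChangeMap lam α) X ↔ IsLocal α X := by
  have hnat : (fun f => f ∘ₗ baseChangeMap lam α) ∘ liftEquiv hX =
      liftEquiv hX ∘ fun g => g ∘ₗ α := funext fun g => hom_ext fun p => by
    simp [liftEquiv, baseChangeMap_of, lift_of]
  rw [IsLocal, IsLocal, ← (liftEquiv hX).bijective_comp, hnat, (liftEquiv hX).comp_bijective]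

end Lift

instance instFinite [Module.Finite Rᵐᵒᵖ P] : Module.Finite Sᵐᵒᵖ (BaseChange lam P) := by
  obtain ⟨t, ht⟩ := Module.Finite.fg_top (R := Rᵐᵒᵖ) (M := P)
  refine ⟨Submodule.fg_def.2 ⟨of lam P '' t, t.finite_toSet.image _, top_unique ?_⟩⟩
  rw [← span_range_of, Submodule.span_le, Set.range_subset_iff]
  intro p
  induction (ht ▸ Submodule.mem_top : p ∈ Submodule.span Rᵐᵒᵖ (t : Set P)) using
    Submodule.span_induction with
  | mem p hp => exact Submodule.subset_span ⟨p, hp, rfl⟩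
  | zero => simp
  | add p p' _ _ hp hp' => rw [map_add]; exact Submodule.add_mem _ hp hp'
  | smul r p _ hp =>
    rw [← op_unop r, of_op_smul]
    exact Submodule.smul_mem _ _ hp

instance instProjective [Module.Projective Rᵐᵒᵖ P] :
    Module.Projective Sᵐᵒᵖ (BaseChange lam P) := by
  refine .of_lifting_property'' fun f hf => ?_
  let _ : Module Rᵐᵒᵖ (BaseChange lam P →₀ Sᵐᵒᵖ) := Module.compHom _ lam.op
  let _ : Module Rᵐᵒᵖ (BaseChange lam P) := Module.compHom _ lam.op
  let f' : (BaseChange lam P →₀ Sᵐᵒᵖ) →ₗ[Rᵐᵒᵖ] BaseChange lam P :=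
    { f with map_smul' := fun r x => map_smul f (lam.op r) x }
  obtain ⟨g, hg⟩ := Module.projective_lifting_property f' ((liftEquiv fun _ _ => rfl).symm .id) hf
  exact ⟨lift (fun _ _ => rfl) g, hom_ext fun p =>
    (congrArg f (lift_of _ g p)).trans (LinearMap.congr_fun hg p)⟩

end BaseChange

/-- A map between finitely generated projective modules is bijective if and only if its dual is, and
the dual `Hom_S(N ⊗_R S, S) → Hom_S(P ⊗_R S, S)` of `α ⊗_R S` is `Hom_R(N, S) → Hom_R(P, S)`. -/
theorem bijective_baseChangeMap_iff [Module Rᵐᵒᵖ S] (hS : ∀ (r : R) (s : S), op r • s = s * lam r)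
    [Module.Finite Rᵐᵒᵖ P] [Module.Projective Rᵐᵒᵖ P] [Module.Finite Rᵐᵒᵖ N]
    [Module.Projective Rᵐᵒᵖ N] {α : P →ₗ[Rᵐᵒᵖ] N} :
    Function.Bijective (baseChangeMap lam α) ↔ IsLocal α S := by
  rw [← isLocal_self_iff, ← BaseChange.isLocal_baseChangeMap_iff (lam := lam) (X := S) hS]
  let e : S ≃ₗ[Sᵐᵒᵖ] Sᵐᵒᵖ := { opAddEquiv with map_smul' := fun _ _ => rfl }
  exact ⟨.of_comp_eq_id e.symm_comp, .of_comp_eq_id e.comp_symm⟩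

end BaseChange

section Closed

variable {A : Type*} [Ring A] {G : IdealFilter A}

theorem isDense_range_of_exact {P N U : Type*} [AddCommGroup P] [Module A P] [AddCommGroup N]
    [Module A N] [AddCommGroup U] [Module A U] {α : P →ₗ[A] N} {β : N →ₗ[A] U}
    (hex : Function.Exact α β) (hU : G.IsTorsion U) : IsDense G (LinearMap.range α) := by
  intro n
  obtain ⟨L, hL, hLn⟩ := hU (β n)
  refine Order.PFilter.mem_of_le (fun a ha => ?_) hL
  rw [Submodule.mem_colon_singleton]
  exact (hex _).1 (by rw [map_smul, hLn a ha])

section Saturation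

variable {M : Type*} [AddCommGroup M] [Module A M]

variable (G) in
/-- The `G`-saturation of a submodule `D` of `M`, the largest submodule in which `D` is
`G`-dense. -/
def saturation [G.IsUniform] (D : Submodule A M) : Submodule A M :=
  (torsionSubmodule G (M ⧸ D)).comap D.mkQ

theorem mem_saturation_iff [G.IsUniform] {D : Submodule A M} {x : M} :
    x ∈ saturation G D ↔ ∃ L ∈ G, ∀ a ∈ L, a • x ∈ D :=
  exists_congr fun L => and_congr_right fun _ => forall₂_congr fun a _ => by
    rw [← map_smul, Submodule.mkQ_apply, Submodule.Quotient.mk_eq_zero]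

end Saturation

namespace IsGClosed

variable {R : Type u} [Ring R] {G : IdealFilter Rᵐᵒᵖ} {C P N : Type*} [AddCommGroup C]
  [Module Rᵐᵒᵖ C] [AddCommGroup P] [Module Rᵐᵒᵖ P] [AddCommGroup N] [Module Rᵐᵒᵖ N]
  {α : P →ₗ[Rᵐᵒᵖ] N}

theorem exists_smul_eq (hC : IsGClosed G C) (hα : Function.Injective α)
    (hd : IsDense G (LinearMap.range α)) (h : P →ₗ[Rᵐᵒᵖ] C) (n : N) :
    ∃ c : C, ∃ I ∈ G, ∀ a ∈ I, ∃ p, α p = a • n ∧ h p = a • c := by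
  let I := (LinearMap.range α).colon {n}
  obtain ⟨k, hk⟩ := exists_lift_of_exact hα (LinearMap.exact_map_mkQ_range α)
    (LinearMap.toSpanSingleton Rᵐᵒᵖ N n ∘ₗ I.subtype) fun a =>
      (Submodule.Quotient.mk_eq_zero _).2 (Submodule.mem_colon_singleton.1 a.2)
  obtain ⟨l, hl⟩ := (hC I (hd n)).2 (h ∘ₗ k)
  refine ⟨l 1, I, hd n, fun a ha => ⟨k ⟨a, ha⟩, hk ⟨a, ha⟩, ?_⟩⟩
  rw [← map_smul, smul_eq_mul, mul_one]
  exact (LinearMap.congr_fun hl ⟨a, ha⟩).symm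

/-- The extension of `h : P → C` along `α` is the map whose graph is the saturation of
`{(α p, h p)}`. -/
theorem exists_extension [G.IsUniform] (hC : IsGClosed G C) (hα : Function.Injective α)
    (hd : IsDense G (LinearMap.range α)) (h : P →ₗ[Rᵐᵒᵖ] C) : ∃ g : N →ₗ[Rᵐᵒᵖ] C, g ∘ₗ α = h := by
  let Γ := saturation G (LinearMap.range (α.prod h))
  have hΓ : Function.Bijective (LinearMap.fst Rᵐᵒᵖ N C ∘ₗ Γ.subtype) := by
    constructor
    · rw [injective_iff_map_eq_zero]
      rintro ⟨⟨n, c⟩, hnc⟩ (rfl : n = 0)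
      obtain ⟨L, hL, hc⟩ := mem_saturation_iff.1 hnc
      have hc0 : c = 0 := hC.eq_zero hL fun a ha => by
        obtain ⟨p, hp⟩ := hc a ha
        obtain ⟨hαp, hhp⟩ := Prod.ext_iff.1 hp
        have hp0 : p = 0 := hα (by simpa using hαp)
        simpa [hp0] using hhp.symm
      simp [hc0]
    · intro n
      obtain ⟨c, I, hI, hc⟩ := hC.exists_smul_eq hα hd h n
      exact ⟨⟨(n, c), mem_saturation_iff.2 ⟨I, hI, fun a ha =>
        (hc a ha).imp fun p hp => Prod.ext hp.1 hp.2⟩⟩, rfl⟩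
  let e := LinearEquiv.ofBijective _ hΓ
  refine ⟨LinearMap.snd Rᵐᵒᵖ N C ∘ₗ Γ.subtype ∘ₗ e.symm, LinearMap.ext fun p => ?_⟩
  have hp : (α p, h p) ∈ Γ := Submodule.le_comap_mkQ _ _ ⟨p, rfl⟩
  exact congrArg (fun x : Γ => x.1.2) (e.symm_apply_apply ⟨_, hp⟩)

theorem isLocal [G.IsUniform] (hC : IsGClosed G C) (hα : Function.Injective α)
    (hd : IsDense G (LinearMap.range α)) : IsLocal α C := by
  refine isLocal_iff.2 ⟨fun g hg => LinearMap.ext fun n => hC.eq_zero (hd n) fun a ha => ?_,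
    hC.exists_extension hα hd⟩
  obtain ⟨p, hp⟩ := Submodule.mem_colon_singleton.1 ha
  rw [← map_smul, ← hp]
  exact LinearMap.congr_fun hg p

theorem of_cofinal [G.IsUniform] (h : ∀ I ∈ G, ∃ J ∈ G, J ≤ I ∧ IsLocal J.subtype C) :
    IsGClosed G C := by
  have hzero : ∀ I ∈ G, ∀ g : Rᵐᵒᵖ →ₗ[Rᵐᵒᵖ] C, g.domRestrict I = 0 → g = 0 := by
    intro I hI g hg
    obtain ⟨J, -, hJI, hJ⟩ := h I hI
    exact (isLocal_iff.1 hJ).1 g (LinearMap.ext fun a => LinearMap.congr_fun hg ⟨a, hJI a.2⟩)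
  refine fun I hI => isLocal_iff.2 ⟨hzero I hI, fun f => ?_⟩
  obtain ⟨J, hJ, hJI, hJC⟩ := h I hI
  obtain ⟨g, hg⟩ := hJC.2 (f ∘ₗ Submodule.inclusion hJI)
  refine ⟨g, LinearMap.ext fun x => ?_⟩
  have hx : LinearMap.toSpanSingleton Rᵐᵒᵖ C (g x - f x) = 0 :=
    hzero _ (IdealFilter.IsUniform.colon_mem hJ (x : Rᵐᵒᵖ)) _ <| LinearMap.ext fun a => by
      have ha : a • (x : Rᵐᵒᵖ) ∈ J := Submodule.mem_colon_singleton.1 a.2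
      have hgf : g (a • (x : Rᵐᵒᵖ)) = f (a • x) := LinearMap.congr_fun hg ⟨_, ha⟩
      change (a : Rᵐᵒᵖ) • (g x - f x) = 0
      rw [smul_sub, ← map_smul, sub_eq_zero]
      exact hgf.trans (map_smul f (a : Rᵐᵒᵖ) x)
  have h1 := LinearMap.congr_fun hx 1
  rw [LinearMap.toSpanSingleton_apply, one_smul, LinearMap.zero_apply, sub_eq_zero] at h1
  exact h1

end IsGClosed

end Closed

section UniversalLocalization

variable {R S : Type u} [Ring R] [Ring S] {lam : R →+* S}
  {W : CategoryTheory.MorphismProperty (ModuleCat.{u} Rᵐᵒᵖ)}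
  {C : CategoryTheory.ObjectProperty (ModuleCat.{u} Rᵐᵒᵖ)}

theorem IsResolvingFor.isInverting_iff (hW : IsResolvingFor W C) [Module Rᵐᵒᵖ S]
    (hS : ∀ (r : R) (s : S), op r • s = s * lam r) :
    IsInverting lam W ↔ ∀ ⦃P N : ModuleCat.{u} Rᵐᵒᵖ⦄ (α : P ⟶ N), W α → IsLocal α.hom S := by
  refine forall₄_congr fun P N α hα => ?_
  obtain ⟨⟨_, _⟩, ⟨_, _⟩, -⟩ := hW.of_mem α hα
  exact bijective_baseChangeMap_iff hS

theorem IsResolvingFor.isInverting_comp (hW : IsResolvingFor W C) (hlam : IsInverting lam W)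
    {T : Type u} [Ring T] (f : S →+* T) : IsInverting (f.comp lam) W := by
  let _ : Module Sᵐᵒᵖ T := Module.compHom T f.op
  let _ : Module Rᵐᵒᵖ T := Module.compHom T (f.comp lam).op
  refine (hW.isInverting_iff fun _ _ => rfl).2 fun P N α hα => ?_
  exact (BaseChange.isLocal_baseChangeMap_iff fun _ _ => rfl).1 (isLocal_of_bijective (hlam α hα))

namespace IsUniversalLocalization

theorem isRingEpimorphism (h : IsUniversalLocalization lam W) (hW : IsResolvingFor W C) :
    IsRingEpimorphism lam := by
  refine ⟨fun {T} f g hfg => RingCat.hom_ext ?_⟩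
  have hcomp : f.hom.comp lam = g.hom.comp lam := congrArg RingCat.Hom.hom hfg
  exact (h.2 T _ (hW.isInverting_comp h.1 f.hom)).unique rfl hcomp.symm

theorem areEquivalent (h : IsUniversalLocalization lam W) {S' : Type u} [Ring S'] {lam' : R →+* S'}
    (h' : IsUniversalLocalization lam' W) : AreEquivalent lam lam' := by
  obtain ⟨φ, hφ, -⟩ := h.2 S' lam' h'.1
  obtain ⟨χ, hχ, -⟩ := h'.2 S lam h.1
  refine ⟨RingEquiv.ofRingHom φ χ ?_ ?_, hφ.symm⟩
  · exact (h'.2 S' lam' h'.1).unique (by rw [RingHom.comp_assoc, hχ, hφ]) (RingHom.id_comp _)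
  · exact (h.2 S lam h.1).unique (by rw [RingHom.comp_assoc, hφ, hχ]) (RingHom.id_comp _)

end IsUniversalLocalization

end UniversalLocalization

section QuotientRing

variable {R S : Type u} [Ring R] [Ring S] {G : IdealFilter Rᵐᵒᵖ} [G.IsGabriel] {ψ : R →+* S}

theorem linearMap_ext_of_comp_toQuotientRing {C : Type*} [AddCommGroup C] [Module Rᵐᵒᵖ C]
    (hC : IsGClosed G C) {f g : QuotientRing G →ₗ[Rᵐᵒᵖ] C}
    (h : ∀ r, f (toQuotientRing G r) = g (toQuotientRing G r)) : f = g := by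
  let lamₗ : R →ₗ[Rᵐᵒᵖ] QuotientRing G :=
    { (toQuotientRing G).toAddMonoidHom with
      map_smul' := fun r r' => map_mul (toQuotientRing G) r' (unop r) }
  exact (existsUnique_extension G hC (g ∘ₗ lamₗ)).unique h fun _ => rfl

namespace IsGClosed

variable [Module Rᵐᵒᵖ S] (hclosed : IsGClosed G S) (hS : ∀ (r : R) (s : S), op r • s = s * ψ r)

include hclosed hS

/-- Both sides of the equation are right `R`-linear in `q'` and agree for `q' ∈ λ(R)`. -/
theorem map_mul_of_forall_map_toQuotientRing {φ : QuotientRing G →ₗ[Rᵐᵒᵖ] S}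
    (hφ : ∀ r, φ (toQuotientRing G r) = ψ r) (q q' : QuotientRing G) : φ (q * q') = φ q * φ q' := by
  have : SMulCommClass Rᵐᵒᵖ (QuotientRing G) (QuotientRing G) :=
    ⟨fun r x y => mul_assoc x y (toQuotientRing G (unop r))⟩
  have : SMulCommClass Rᵐᵒᵖ S S := ⟨fun r x y => by
    rw [← op_unop r, hS, smul_eq_mul, smul_eq_mul, hS, mul_assoc]⟩
  refine LinearMap.congr_fun (f := φ ∘ₗ LinearMap.mulLeft Rᵐᵒᵖ q)
    (g := LinearMap.mulLeft Rᵐᵒᵖ (φ q) ∘ₗ φ) ?_ q'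
  refine linearMap_ext_of_comp_toQuotientRing hclosed fun r => ?_
  calc φ (q * toQuotientRing G r) = φ q * ψ r := (map_smul φ (op r) q).trans (hS r _)
    _ = φ q * φ (toQuotientRing G r) := by rw [hφ]

theorem existsUnique_ringHom :
    ∃! φ : QuotientRing G →+* S, φ.comp (toQuotientRing G) = ψ := by
  let ψₗ : R →ₗ[Rᵐᵒᵖ] S :=
    { ψ.toAddMonoidHom with
      map_smul' := fun r r' => (map_mul ψ r' (unop r)).trans (hS (unop r) (ψ r')).symm }
  obtain ⟨φ, hφ, -⟩ := existsUnique_extension G hclosed ψₗ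
  refine ⟨{ φ.toAddMonoidHom with
    map_one' := (congrArg φ (map_one (toQuotientRing G)).symm).trans ((hφ 1).trans (map_one ψ))
    map_mul' := hclosed.map_mul_of_forall_map_toQuotientRing hS hφ },
    RingHom.ext hφ, fun χ hχ => ?_⟩
  have hχ : ∀ r, χ (toQuotientRing G r) = ψ r := RingHom.congr_fun hχ
  let χₗ : QuotientRing G →ₗ[Rᵐᵒᵖ] S :=
    { χ.toAddMonoidHom with
      map_smul' := fun r q => (map_mul χ q (toQuotientRing G (unop r))).trans <| by
        rw [hχ]
        exact (hS (unop r) (χ q)).symm }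
  have hχφ : χₗ = φ :=
    linearMap_ext_of_comp_toQuotientRing hclosed fun r => (hχ r).trans (hφ r).symm
  exact RingHom.ext (LinearMap.congr_fun hχφ)

end IsGClosed

variable {W : CategoryTheory.MorphismProperty (ModuleCat.{u} Rᵐᵒᵖ)}
  {C : CategoryTheory.ObjectProperty (ModuleCat.{u} Rᵐᵒᵖ)}

namespace IsResolvingFor

theorem isInverting_toQuotientRing (hW : IsResolvingFor W C) (hC : ∀ U, C U → G.IsTorsion U) :
    IsInverting (toQuotientRing G) W := by
  refine (hW.isInverting_iff fun _ _ => rfl).2 fun P N α hα => ?_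
  obtain ⟨-, -, hinj, U, hU, β, -, hex⟩ := hW.of_mem α hα
  exact (isGClosed_quotientRing G).isLocal hinj (isDense_range_of_exact hex (hC U hU))

theorem isGClosed_of_isInverting (hW : IsResolvingFor W C)
    (hC : ∀ I ∈ G, ∃ J ∈ G, J ≤ I ∧ C (ModuleCat.of Rᵐᵒᵖ (Rᵐᵒᵖ ⧸ J)))
    [Module Rᵐᵒᵖ S] (hS : ∀ (r : R) (s : S), op r • s = s * ψ r) (hψ : IsInverting ψ W) :
    IsGClosed G S := by
  refine .of_cofinal fun I hI => ?_
  obtain ⟨J, hJ, hJI, hCJ⟩ := hC I hI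
  obtain ⟨P, N, α, β, hα, hβ, hex⟩ := hW.exists_resolution _ hCJ
  obtain ⟨-, ⟨-, _⟩, -⟩ := hW.of_mem α hα
  have hlocal : IsLocal α.hom S := (hW.isInverting_iff hS).1 hψ α hα
  exact ⟨J, hJ, hJI, hlocal.of_exact J.injective_subtype hex hβ
    (LinearMap.exact_subtype_mkQ J) J.mkQ_surjective⟩

theorem isUniversalLocalization_toQuotientRing (hW : IsResolvingFor W C)
    (htors : ∀ U, C U → G.IsTorsion U)
    (hcof : ∀ I ∈ G, ∃ J ∈ G, J ≤ I ∧ C (ModuleCat.of Rᵐᵒᵖ (Rᵐᵒᵖ ⧸ J))) :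
    IsUniversalLocalization (toQuotientRing G) W := by
  refine ⟨hW.isInverting_toQuotientRing htors, fun S _ ψ hψ => ?_⟩
  let _ : Module Rᵐᵒᵖ S := Module.compHom S ψ.op
  have hS : ∀ (r : R) (s : S), op r • s = s * ψ r := fun _ _ => rfl
  exact (hW.isGClosed_of_isInverting hcof hS hψ).existsUnique_ringHom hS

end IsResolvingFor

end QuotientRing

section Resolutions

variable {R : Type u} [Ring R] {C : CategoryTheory.ObjectProperty (ModuleCat.{u} Rᵐᵒᵖ)}

variable (C) in
/-- The class of all monomorphisms between finitely generated projective modules whose cokernel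
belongs to `C`. -/
def resolutions : CategoryTheory.MorphismProperty (ModuleCat.{u} Rᵐᵒᵖ) := fun P N α =>
  (Module.Finite Rᵐᵒᵖ P ∧ Module.Projective Rᵐᵒᵖ P) ∧
  (Module.Finite Rᵐᵒᵖ N ∧ Module.Projective Rᵐᵒᵖ N) ∧ Function.Injective α.hom ∧
  ∃ U, C U ∧ ∃ β : N ⟶ U, Function.Surjective β.hom ∧ Function.Exact α.hom β.hom

theorem isResolvingFor_resolutions (hfp : ∀ U, C U → Module.FinitePresentation Rᵐᵒᵖ U)
    (hpd : ∀ U, C U → CategoryTheory.HasProjectiveDimensionLE U 1) :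
    IsResolvingFor (resolutions C) C := by
  refine ⟨fun P N α hα => hα, fun U hU => ?_⟩
  have := hfp U hU
  obtain ⟨n, f, hf⟩ := Module.Finite.exists_fin' Rᵐᵒᵖ U
  let N := ModuleCat.of Rᵐᵒᵖ (Fin n → Rᵐᵒᵖ)
  have hN : Module.Finite Rᵐᵒᵖ N := Module.Finite.pi
  have hN' : Module.Projective Rᵐᵒᵖ N := Module.Projective.of_free
  have hker : Module.Finite Rᵐᵒᵖ (LinearMap.ker f) := .of_fg (Module.FinitePresentation.fg_ker f hf)
  have hproj : Module.Projective Rᵐᵒᵖ (LinearMap.ker f) :=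
    (hasProjectiveDimensionLE_one_iff_projective_ker (M := N) hf).1 (hpd U hU)
  have hex : Function.Exact (LinearMap.ker f).subtype f := f.exact_subtype_ker_map
  let α : ModuleCat.of Rᵐᵒᵖ (LinearMap.ker f) ⟶ N := ModuleCat.ofHom (LinearMap.ker f).subtype
  let β : N ⟶ U := ModuleCat.ofHom f
  have hα : resolutions C α :=
    ⟨⟨hker, hproj⟩, ⟨hN, hN'⟩, (LinearMap.ker f).injective_subtype, U, hU, β, hf, hex⟩
  exact ⟨_, _, α, β, hα, hf, hex⟩

theorem IsRightSemihereditary.hasProjectiveDimensionLE_one (hR : IsRightSemihereditary R)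
    (U : ModuleCat.{u} Rᵐᵒᵖ) [Module.FinitePresentation Rᵐᵒᵖ U] :
    CategoryTheory.HasProjectiveDimensionLE U 1 := by
  obtain ⟨n, f, hf⟩ := Module.Finite.exists_fin' Rᵐᵒᵖ U
  have : Module.Finite Rᵐᵒᵖ (LinearMap.ker f) := .of_fg (Module.FinitePresentation.fg_ker f hf)
  have : Module.Projective Rᵐᵒᵖ (ModuleCat.of Rᵐᵒᵖ (Fin n → Rᵐᵒᵖ)) := Module.Projective.of_free
  exact (hasProjectiveDimensionLE_one_iff_projective_ker
    (M := ModuleCat.of Rᵐᵒᵖ (Fin n → Rᵐᵒᵖ)) hf).2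
    (projective_of_injective hR (LinearMap.ker f).injective_subtype)

end Resolutions

section TorsionPair

variable {R : Type u} [Ring R] {T F : CategoryTheory.ObjectProperty (ModuleCat.{u} Rᵐᵒᵖ)}

namespace IsHereditaryTorsionPair

theorem of_surjective (hTF : IsHereditaryTorsionPair T F) {M N : ModuleCat.{u} Rᵐᵒᵖ} (hM : T M)
    {f : M →ₗ[Rᵐᵒᵖ] N} (hf : Function.Surjective f) : T N :=
  (hTF.torsion_iff N).2 fun X hX g =>
    (LinearMap.cancel_right hf).1 ((hTF.torsion_iff M).1 hM X hX (g ∘ₗ f))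

theorem isTorsion (hTF : IsHereditaryTorsionPair T F) {G : IdealFilter Rᵐᵒᵖ}
    (hGT : CorrespondsTo G T) {U : ModuleCat.{u} Rᵐᵒᵖ} (hU : T U) : G.IsTorsion U := fun x =>
  let f := LinearMap.toSpanSingleton Rᵐᵒᵖ U x
  ⟨LinearMap.ker f,
    (hGT _).2 (hTF.of_surjective (hTF.submodule U hU (LinearMap.range f))
      (f := f.quotKerEquivRange.symm) f.quotKerEquivRange.symm.surjective),
    fun _ ha => ha⟩

end IsHereditaryTorsionPair

end TorsionPair

section Perfect

variable {R : Type u} [Ring R] {G : IdealFilter Rᵐᵒᵖ} [G.IsGabriel]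

theorem colon_mem_of_toQuotientRing_eq {K : Ideal Rᵐᵒᵖ} {b c : Rᵐᵒᵖ} (hc : c ∈ K)
    (h : toQuotientRing G (unop b) = toQuotientRing G (unop c)) : K.colon {b} ∈ G := by
  have hbc : toQuotientRing G (unop (b - c)) = 0 := by rw [unop_sub, map_sub, h, sub_self]
  obtain ⟨L, hL, hLbc⟩ := (Submodule.Quotient.mk_eq_zero _).1 (toQuotientRing_eq_zero hbc)
  refine Order.PFilter.mem_of_le (fun a ha => Submodule.mem_colon_singleton.2 ?_) hL
  have hab : a • b = a • c := sub_eq_zero.1 ((smul_sub a b c).symm.trans (hLbc a ha))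
  rw [hab]
  exact K.smul_mem a hc

theorem exists_fg_forall_exists_smul_eq {I : Ideal Rᵐᵒᵖ} {x : QuotientRing G}
    (hx : x ∈ AddSubgroup.closure {y | ∃ a ∈ I, ∃ q : QuotientRing G, y = unop a • q}) :
    ∃ K ≤ I, K.FG ∧ ∃ J ∈ G, ∀ b ∈ J, ∃ c ∈ K, b • x = toQuotientRing G (unop c) := by
  induction hx using AddSubgroup.closure_induction with
  | mem x hx =>
    obtain ⟨a, ha, q, rfl⟩ := hx
    obtain ⟨J, hJ, hq⟩ := exists_smul_eq q
    refine ⟨Ideal.span {a}, (Ideal.span_singleton_le_iff_mem I).2 ha,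
      Submodule.fg_span_singleton a, J, hJ, fun b hb => ?_⟩
    obtain ⟨s, hs⟩ := hq b hb
    refine ⟨s * a, Ideal.mul_mem_left _ s (Ideal.mem_span_singleton_self a), ?_⟩
    calc b • unop a • q = toQuotientRing G (unop a) * b • q := mul_assoc _ _ _
      _ = toQuotientRing G (unop (s * a)) := by rw [hs, unop_mul, map_mul]
  | zero =>
    obtain ⟨J, hJ⟩ := G.nonempty
    exact ⟨⊥, bot_le, Submodule.fg_bot, J, hJ, fun b _ => ⟨0, rfl, by simp⟩⟩
  | add x y _ _ hx hy =>
    obtain ⟨K, hKI, hK, J, hJ, hx⟩ := hx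
    obtain ⟨K', hKI', hK', J', hJ', hy⟩ := hy
    refine ⟨K ⊔ K', sup_le hKI hKI', Submodule.FG.sup hK hK', J ⊓ J', Order.PFilter.inf_mem hJ hJ',
      fun b hb => ?_⟩
    obtain ⟨c, hc, hbx⟩ := hx b hb.1
    obtain ⟨c', hc', hby⟩ := hy b hb.2
    exact ⟨c + c', Submodule.add_mem_sup hc hc', by rw [smul_add, hbx, hby, unop_add, map_add]⟩
  | neg x _ hx =>
    obtain ⟨K, hKI, hK, J, hJ, hx⟩ := hx
    refine ⟨K, hKI, hK, J, hJ, fun b hb => ?_⟩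
    obtain ⟨c, hc, hbx⟩ := hx b hb
    exact ⟨-c, K.neg_mem hc, by rw [smul_neg, hbx, unop_neg, map_neg]⟩

namespace IsPerfect

theorem exists_fg_le (hG : IsPerfect G) {I : Ideal Rᵐᵒᵖ} (hI : I ∈ G) :
    ∃ K ∈ G, K ≤ I ∧ K.FG := by
  obtain ⟨K, hKI, hK, J, hJ, hJK⟩ :=
    exists_fg_forall_exists_smul_eq (hG I hI ▸ AddSubgroup.mem_top (1 : QuotientRing G))
  refine ⟨K, IdealFilter.IsGabriel.gabriel_closed _ ⟨J, hJ, fun b hb => ?_⟩, hKI, hK⟩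
  obtain ⟨c, hc, hbc⟩ := hJK b hb
  exact colon_mem_of_toQuotientRing_eq hc ((one_mul _).symm.trans hbc)

theorem exists_le_finitelyPresentedIn (hG : IsPerfect G)
    {T : CategoryTheory.ObjectProperty (ModuleCat.{u} Rᵐᵒᵖ)} (hGT : CorrespondsTo G T)
    {I : Ideal Rᵐᵒᵖ} (hI : I ∈ G) :
    ∃ K ∈ G, K ≤ I ∧ finitelyPresentedIn T (ModuleCat.of Rᵐᵒᵖ (Rᵐᵒᵖ ⧸ K)) := by
  obtain ⟨K, hK, hKI, hfg⟩ := hG.exists_fg_le hI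
  exact ⟨K, hK, hKI, (hGT K).1 hK, Module.finitePresentation_of_surjective K.mkQ K.mkQ_surjective
    (by rwa [Submodule.ker_mkQ])⟩

end IsPerfect

end Perfect

end PerfectLocalization

theorem proposition4p4_general {R : Type u} [Ring R] (G : IdealFilter Rᵐᵒᵖ) [G.IsGabriel]
    (C : CategoryTheory.ObjectProperty (ModuleCat.{u} Rᵐᵒᵖ))
    (hfp : ∀ U, C U → Module.FinitePresentation Rᵐᵒᵖ U)
    (hpd : ∀ U, C U → CategoryTheory.HasProjectiveDimensionLE U 1)
    (htors : ∀ U, C U → G.IsTorsion U)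
    (hcof : ∀ I ∈ G, ∃ J ∈ G, J ≤ I ∧ C (ModuleCat.of Rᵐᵒᵖ (Rᵐᵒᵖ ⧸ J))) :
    PerfectLocalization.IsRingEpimorphism (PerfectLocalization.toQuotientRing G) ∧
    PerfectLocalization.IsUniversalLocalizationAt (PerfectLocalization.toQuotientRing G) C ∧
    ∀ (S : Type u) [Ring S] (lam : R →+* S),
      PerfectLocalization.IsUniversalLocalizationAt lam C →
      PerfectLocalization.AreEquivalent (PerfectLocalization.toQuotientRing G) lam := by
  have hres := PerfectLocalization.isResolvingFor_resolutions hfp hpd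
  have huniv := hres.isUniversalLocalization_toQuotientRing htors hcof
  refine ⟨huniv.isRingEpimorphism hres, ⟨_, hres, huniv⟩, ?_⟩
  rintro S _ lam ⟨W, hW, hlam⟩
  exact (hW.isUniversalLocalization_toQuotientRing htors hcof).areEquivalent hlam

theorem proposition4p4 {R : Type u} [Ring R]
    (hR : PerfectLocalization.IsRightSemihereditary R)
    (G : IdealFilter Rᵐᵒᵖ) [G.IsGabriel] (hG : PerfectLocalization.IsPerfect G)
    (T F : CategoryTheory.ObjectProperty (ModuleCat.{u} Rᵐᵒᵖ))
    (hTF : PerfectLocalization.IsHereditaryTorsionPair T F)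
    (hGT : PerfectLocalization.CorrespondsTo G T) :
    PerfectLocalization.IsRingEpimorphism (PerfectLocalization.toQuotientRing G) ∧
    (∃ (S : Type u) (_ : Ring S) (lam : R →+* S),
      PerfectLocalization.IsUniversalLocalizationAt lam
        (PerfectLocalization.finitelyPresentedIn T)) ∧
    ∀ (S : Type u) [Ring S] (lam : R →+* S),
      PerfectLocalization.IsUniversalLocalizationAt lam
        (PerfectLocalization.finitelyPresentedIn T) →
      PerfectLocalization.AreEquivalent (PerfectLocalization.toQuotientRing G) lam := by
  have hpd (U) (hU : PerfectLocalization.finitelyPresentedIn T U) :=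
    have := hU.2
    hR.hasProjectiveDimensionLE_one U
  obtain ⟨hepi, hloc, hequiv⟩ :=
    proposition4p4_general G (PerfectLocalization.finitelyPresentedIn T) (fun _ hU => hU.2) hpd
      (fun _ hU => hTF.isTorsion hGT hU.1) fun _ hI => hG.exists_le_finitelyPresentedIn hGT hI
  exact ⟨hepi, ⟨_, _, _, hloc⟩, hequiv⟩
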